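/- Let $A$ be a (not necessarily unital) $C^*$-algebra. A state of $A$ is a positive linear functional of norm one, and a pure state is an extreme point of the set of states. Let $P(A)$ be the weak$^*$-closure of the set of pure states of $A$ in the dual of $A$, with the zero functional removed. Let $R(A)$ be the equivalence relation on $P(A)$ under which $\alpha$ and $\beta$ are equivalent if and only if their Gelfand--Naimark--Segal representations $\pi_\alpha : A \to B(H_\alpha)$ and $\pi_\beta : A \to B(H_\beta)$ are unitarily equivalent, i.e. there is a unitary $U : H_\alpha \to H_\beta$ with $U\pi_\alpha(a) = \pi_\beta(a)U$ for all $a \in A$. Then $A$ is commutative if and only if $R(A)$ is discrete, i.e. every equivalence class of $R(A)$ is a singleton. -/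

import Mathlib

open scoped ComplexOrder

noncomputable section

namespace CStarQuantum

section Representations

variable {A : Type*} [NonUnitalCStarAlgebra A]
  {H : Type*} [NormedAddCommGroup H] [InnerProductSpace ℂ H] [CompleteSpace H]
  {K : Type*} [NormedAddCommGroup K] [InnerProductSpace ℂ K] [CompleteSpace K]

/-- Two representations `π`, `ρ` of a C⋆-algebra on Hilbert spaces `H`, `K` are (unitarily)
equivalent if some unitary operator `U : H → K` satisfies `U π(a) = ρ(a) U` for all `a`. -/
def UnitarilyEquivalent (π : A →⋆ₙₐ[ℂ] (H →L[ℂ] H)) (ρ : A →⋆ₙₐ[ℂ] (K →L[ℂ] K)) : Prop :=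
  ∃ U : H ≃ₗᵢ[ℂ] K, ∀ (a : A) (x : H), U (π a x) = ρ a (U x)

end Representations

variable (A : Type*) [NonUnitalCStarAlgebra A] [PartialOrder A]

/-- The state space of `A`: positive linear functionals of norm one, as a subset of the dual
of `A` with the weak⋆ topology. -/
def stateSpace : Set (WeakDual ℂ A) :=
  {φ | (∀ a : A, 0 ≤ a → 0 ≤ φ a) ∧ ‖WeakDual.toStrongDual φ‖ = 1}

/-- `PS(A)`: the pure states of `A`, i.e. the extreme points of the state space. -/
def pureStates : Set (WeakDual ℂ A) :=
  (stateSpace A).extremePoints ℝ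

/-- `P(A)`: the weak⋆ closure of the set of pure states, with the zero functional removed. -/
def pureSpace : Set (WeakDual ℂ A) :=
  closure (pureStates A) \ {0}

variable {A}

theorem nonneg_of_mem_pureSpace {φ : WeakDual ℂ A} (hφ : φ ∈ pureSpace A) (a : A) (ha : 0 ≤ a) :
    0 ≤ φ a := by
  have hcl : IsClosed {ψ : WeakDual ℂ A | 0 ≤ ψ a} :=
    isClosed_Ici.preimage (WeakDual.eval_continuous a)
  exact closure_minimal (fun ψ hψ => hψ.1.1 a ha) hcl hφ.1

/-- An element of `P(A)`, as a positive linear functional on `A`. -/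
def toPositive [StarOrderedRing A] (φ : pureSpace A) : A →ₚ[ℂ] ℂ :=
  PositiveLinearMap.mk₀ (φ.1 : A →ₗ[ℂ] ℂ) (fun a ha => nonneg_of_mem_pureSpace φ.2 a ha)

@[simp]
theorem toPositive_apply [StarOrderedRing A] (φ : pureSpace A) (a : A) : toPositive φ a = φ.1 a := rfl

variable (A) [StarOrderedRing A]

/-- `R(A)`: the equivalence relation on `P(A)` for which two functionals are equivalent when
their Gelfand-Naimark-Segal representations are unitarily equivalent. -/
def gnsRel : Setoid (pureSpace A) where
  r α β := UnitarilyEquivalent (toPositive α).gnsNonUnitalStarAlgHom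
    (toPositive β).gnsNonUnitalStarAlgHom
  iseqv :=
    { refl := fun _ => ⟨LinearIsometryEquiv.refl ℂ _, fun _ _ => rfl⟩
      symm := by
        rintro _ _ ⟨U, hU⟩
        exact ⟨U.symm, fun a x => by
          rw [LinearIsometryEquiv.symm_apply_eq, hU, LinearIsometryEquiv.apply_symm_apply]⟩
      trans := by
        rintro _ _ _ ⟨U, hU⟩ ⟨V, hV⟩
        exact ⟨U.trans V, fun a x => by
          rw [LinearIsometryEquiv.trans_apply, hU, hV, LinearIsometryEquiv.trans_apply]⟩ }

end CStarQuantum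

end

/-! Suppose `A` is commutative. A positive functional dominated by a pure state φ is a multiple of φ
(`eq_norm_smul_of_add_mem_pureStates`). For 0 ≤ b of norm at most one this applies to a ↦ φ(ab), and
it makes φ multiplicative. Multiplicativity survives weak-⋆ limits, so it holds on all of P(A). The
GNS representation of a multiplicative α is a ↦ α(a)·1 on a nonzero space, so its equivalence class
determines α.

Conversely, let φ be pure and u a unitary of the unitization. Then x ↦ φ(u⋆xu) is pure, and right
multiplication by u induces an equivalence of its GNS representation with that of φ
(`gnsRel_rotate`). If classes are singletons, φ is invariant under all these conjugations. Unitaries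
span the unitization, so φ(ab) = φ(ba). Pure states separate points by Krein–Milman
(`eq_zero_of_forall_pureStates`), hence ab = ba. -/

open scoped Topology
open Filter

/-! ### Extending isometries to completions. -/

section Completion

open UniformSpace

variable {𝕜 E F : Type*} [NontriviallyNormedField 𝕜] [SeminormedAddCommGroup E] [NormedSpace 𝕜 E]
  [SeminormedAddCommGroup F] [NormedSpace 𝕜 F]

/-- A linear isometric equivalence extends to the completions. -/
noncomputable def LinearIsometryEquiv.mapCompletion (e : E ≃ₗᵢ[𝕜] F) :
    Completion E ≃ₗᵢ[𝕜] Completion F where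
  toLinearEquiv := LinearEquiv.ofLinearMap
    (e.toContinuousLinearEquiv : E →L[𝕜] F).completion.toLinearMap
    (e.symm.toContinuousLinearEquiv : F →L[𝕜] E).completion.toLinearMap
    (by
      ext x
      induction x using Completion.induction_on with
      | hp => apply isClosed_eq <;> simp <;> fun_prop
      | ih x => simp)
    (by
      ext x
      induction x using Completion.induction_on with
      | hp => apply isClosed_eq <;> simp <;> fun_prop
      | ih x => simp)
  norm_map' x := by
    induction x using Completion.induction_on with
    | hp =>
      exact isClosed_eq (e.toContinuousLinearEquiv : E →L[𝕜] F).completion.continuous.norm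
        continuous_norm
    | ih x => simp

@[simp]
lemma LinearIsometryEquiv.mapCompletion_coe (e : E ≃ₗᵢ[𝕜] F) (x : E) :
    e.mapCompletion (x : Completion E) = (e x : Completion F) := by
  simp [mapCompletion]

lemma LinearIsometryEquiv.continuous_mapCompletion (e : E ≃ₗᵢ[𝕜] F) :
    Continuous e.mapCompletion := e.mapCompletion.continuous

end Completion

/-! ### GNS representations of positive functionals. -/

namespace PositiveLinearMap

variable {A : Type*} [NonUnitalCStarAlgebra A] [PartialOrder A] [StarOrderedRing A]

/-- Two positive functionals have equivalent GNS representations if one is obtained from the other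
by a linear bijection of the algebra that commutes with left multiplication. -/
lemma unitarilyEquivalent_gns_of_linearEquiv (f g : A →ₚ[ℂ] ℂ) (R : A ≃ₗ[ℂ] A)
    (hR : ∀ a x, R (a * x) = a * R x) (hfg : ∀ x, f (star x * x) = g (star (R x) * R x)) :
    CStarQuantum.UnitarilyEquivalent f.gnsNonUnitalStarAlgHom g.gnsNonUnitalStarAlgHom := by
  let e : f.PreGNS ≃ₗᵢ[ℂ] g.PreGNS :=
    { toLinearEquiv := f.ofPreGNS.trans (R.trans g.toPreGNS)
      norm_map' := fun x => by simp [preGNS_norm_def, hfg] }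
  refine ⟨e.mapCompletion, fun a x => ?_⟩
  induction x using UniformSpace.Completion.induction_on with
  | hp =>
    exact isClosed_eq
      (e.continuous_mapCompletion.comp (f.gnsNonUnitalStarAlgHom a).continuous)
      ((g.gnsNonUnitalStarAlgHom a).continuous.comp e.continuous_mapCompletion)
  | ih x =>
    rw [gnsNonUnitalStarAlgHom_apply_coe, LinearIsometryEquiv.mapCompletion_coe,
      LinearIsometryEquiv.mapCompletion_coe, gnsNonUnitalStarAlgHom_apply_coe]
    exact congrArg (fun y => ((g.toPreGNS y : g.PreGNS) : g.GNS)) (hR a (f.ofPreGNS x))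

/-- The Cauchy-Schwarz inequality for positive functionals. -/
lemma norm_apply_star_mul_sq_le (f : A →ₚ[ℂ] ℂ) (x y : A) :
    ‖f (star x * y)‖ ^ 2 ≤ ‖f (star x * x)‖ * ‖f (star y * y)‖ := by
  have h := norm_inner_le_norm (𝕜 := ℂ) (f.toPreGNS x) (f.toPreGNS y)
  have hx := congrArg norm (f.preGNS_norm_sq (f.toPreGNS x))
  have hy := congrArg norm (f.preGNS_norm_sq (f.toPreGNS y))
  simp only [preGNS_inner_def, ofPreGNS_toPreGNS, norm_pow, Complex.norm_real,
    norm_norm] at h hx hy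
  rw [← hx, ← hy, ← mul_pow]
  gcongr

/-- The GNS representation of a multiplicative functional `f` acts by scalars. -/
lemma gns_apply_of_multiplicative (f : A →ₚ[ℂ] ℂ) (hf : ∀ a b, f (a * b) = f a * f b) (a : A)
    (x : f.GNS) : f.gnsNonUnitalStarAlgHom a x = f a • x := by
  induction x using UniformSpace.Completion.induction_on with
  | hp =>
    exact isClosed_eq (f.gnsNonUnitalStarAlgHom a).continuous (continuous_const_smul (f a))
  | ih x =>
    -- The vector ax − f(a)x is null: `f` is multiplicative and vanishes on it.
    rw [gnsNonUnitalStarAlgHom_apply_coe, ← UniformSpace.Completion.coe_smul, ← sub_eq_zero,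
      ← UniformSpace.Completion.coe_sub, ← norm_eq_zero, UniformSpace.Completion.norm_coe,
      preGNS_norm_def]
    simp [hf]

/-- On a zero GNS space `f` would kill every b⋆b, hence every positive element, and these span `A`.
-/
lemma exists_gns_ne_zero {f : A →ₚ[ℂ] ℂ} (hf : ∃ a, f a ≠ 0) : ∃ x : f.GNS, x ≠ 0 := by
  by_contra! h
  obtain ⟨a, ha⟩ := hf
  have hsq : ∀ b, f (star b * b) = 0 := fun b => by
    rw [← f.ofPreGNS_toPreGNS b, ← preGNS_norm_sq, ← UniformSpace.Completion.norm_coe,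
      h (f.toPreGNS b : f.GNS)]
    simp
  have hpos : ∀ b, 0 ≤ b → f b = 0 := fun b hb => by
    obtain ⟨c, rfl⟩ := CStarAlgebra.nonneg_iff_eq_star_mul_self.mp hb
    exact hsq c
  obtain ⟨x, hx, -, rfl⟩ := CStarAlgebra.exists_sum_four_nonneg a
  simp [hpos _ (hx _)] at ha

end PositiveLinearMap

namespace CStarQuantum

variable {A : Type*} [NonUnitalCStarAlgebra A] [PartialOrder A] [StarOrderedRing A]

/-- A multiplicative functional of `P(A)` is alone in its class. -/
lemma eq_of_gnsRel_of_multiplicative {α β : pureSpace A}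
    (hα : ∀ a b, α.1 (a * b) = α.1 a * α.1 b) (hβ : ∀ a b, β.1 (a * b) = β.1 a * β.1 b)
    (h : gnsRel A α β) : α = β := by
  obtain ⟨U, hU⟩ := h
  have hne : ∃ a, toPositive α a ≠ 0 := by
    by_contra! h0
    exact α.2.2 (DFunLike.ext _ _ h0)
  obtain ⟨x, hx⟩ := PositiveLinearMap.exists_gns_ne_zero hne
  refine Subtype.ext (DFunLike.ext _ _ fun a => ?_)
  have := hU a x
  rw [PositiveLinearMap.gns_apply_of_multiplicative _ hα,
    PositiveLinearMap.gns_apply_of_multiplicative _ hβ, map_smul] at this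
  exact smul_left_injective ℂ (by simpa using hx : U x ≠ 0) this

end CStarQuantum

/-! ### Norms of positive functionals; multiplicativity of pure states. -/

namespace CStarQuantum

variable {A : Type*} [NonUnitalCStarAlgebra A] [PartialOrder A] [StarOrderedRing A]

/-- The positive linear map underlying a weak-⋆ functional that is nonnegative on `A₊`. -/
noncomputable abbrev toPositiveLinearMap (φ : WeakDual ℂ A) (h : ∀ a : A, 0 ≤ a → 0 ≤ φ a) :
    A →ₚ[ℂ] ℂ :=
  PositiveLinearMap.mk₀ (φ : A →ₗ[ℂ] ℂ) h

omit [PartialOrder A] [StarOrderedRing A] in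
lemma real_smul_apply (r : ℝ) (φ : WeakDual ℂ A) (a : A) : (r • φ) a = r * φ a :=
  Complex.real_smul

omit [PartialOrder A] [StarOrderedRing A] in
lemma norm_apply_le (φ : WeakDual ℂ A) (a : A) : ‖φ a‖ ≤ ‖WeakDual.toStrongDual φ‖ * ‖a‖ :=
  (WeakDual.toStrongDual φ).le_opNorm a

/-- A positive functional attains its norm along the approximate unit. -/
lemma tendsto_approximateUnit {φ : WeakDual ℂ A} (h : ∀ a : A, 0 ≤ a → 0 ≤ φ a) :
    Tendsto φ (CStarAlgebra.approximateUnit A) (𝓝 (‖WeakDual.toStrongDual φ‖ : ℂ)) := by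
  set N := ‖WeakDual.toStrongDual φ‖ with hN
  have hl := CStarAlgebra.increasingApproximateUnit A
  have := hl.neBot
  have hmono : ∀ a b : A, a ≤ b → ‖φ a‖ ≤ ‖φ b‖ ∨ ¬ 0 ≤ a := fun a b hab => by
    by_cases ha : 0 ≤ a
    · left
      refine CStarAlgebra.norm_le_norm_of_nonneg_of_le (h a ha) ?_
      have := h (b - a) (sub_nonneg.mpr hab)
      rwa [map_sub, sub_nonneg] at this
    · exact .inr ha
  -- If `M` bounded all these values, Cauchy–Schwarz along the approximate unit would give |φ(a)|² ≤
  -- MN‖a‖², so N ≤ √(MN) < N.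
  have key : ∀ M : ℝ, M < N → ∃ e : A, 0 ≤ e ∧ ‖e‖ < 1 ∧ M < ‖φ e‖ := by
    intro M hM
    by_contra! hcon
    have hNnn : 0 ≤ N := norm_nonneg _
    have hM0 : 0 ≤ M := by simpa using hcon 0 le_rfl (by simp)
    have hNpos : 0 < N := hM0.trans_lt hM
    have hle : ∀ e : A, 0 ≤ e → ‖e‖ ≤ 1 → ‖φ e‖ ≤ M := by
      intro e he he1
      have hlim : Tendsto (fun t : ℝ => ‖φ (t • e)‖) (𝓝[<] 1) (𝓝 ‖φ ((1 : ℝ) • e)‖) := by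
        have hc : Continuous fun t : ℝ => ‖φ (t • e)‖ :=
          (φ.continuous.comp (continuous_id.smul continuous_const)).norm
        exact (hc.tendsto 1).mono_left nhdsWithin_le_nhds
      rw [one_smul] at hlim
      refine le_of_tendsto hlim ?_
      filter_upwards [Ioo_mem_nhdsLT (zero_lt_one' ℝ)] with t ht
      refine hcon _ (smul_nonneg ht.1.le he) ?_
      rw [norm_smul, Real.norm_of_nonneg ht.1.le]
      nlinarith [ht.1, ht.2, norm_nonneg e]
    have hbound : ∀ a : A, ‖φ a‖ ^ 2 ≤ M * N * ‖a‖ ^ 2 := by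
      intro a
      have hlim : Tendsto (fun e => ‖φ (e * a)‖ ^ 2) (CStarAlgebra.approximateUnit A)
          (𝓝 (‖φ a‖ ^ 2)) :=
        (((φ.continuous.tendsto a).comp (hl.tendsto_mul_right a)).norm).pow 2
      refine le_of_tendsto hlim ?_
      filter_upwards [hl.eventually_nonneg, hl.eventually_norm] with e he he1
      have hcs := (toPositiveLinearMap φ h).norm_apply_star_mul_sq_le e a
      have hes : star e = e := (IsSelfAdjoint.of_nonneg he).star_eq
      rw [hes] at hcs
      have h1 : ‖φ (e * e)‖ ≤ M := by
        refine hle _ ((IsSelfAdjoint.of_nonneg he).mul_self_nonneg) ?_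
        exact (norm_mul_le _ _).trans (mul_le_one₀ he1 (norm_nonneg _) he1)
      have h2 : ‖φ (star a * a)‖ ≤ N * ‖a‖ ^ 2 := by
        refine (norm_apply_le φ _).trans ?_
        rw [CStarRing.norm_star_mul_self, sq]
      calc ‖φ (e * a)‖ ^ 2 ≤ ‖φ (e * e)‖ * ‖φ (star a * a)‖ := hcs
        _ ≤ M * (N * ‖a‖ ^ 2) := by gcongr
        _ = _ := by ring
    have hop : N ≤ √(M * N) := by
      refine ContinuousLinearMap.opNorm_le_bound _ (Real.sqrt_nonneg _) fun a => ?_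
      refine le_of_sq_le_sq ?_ (by positivity)
      rw [mul_pow, Real.sq_sqrt (by positivity)]
      exact hbound a
    have := Real.sqrt_lt_sqrt (by positivity) (mul_lt_mul_of_pos_right hM hNpos)
    rw [Real.sqrt_mul_self hNnn] at this
    exact absurd hop (not_le.mpr this)
  have hreal : Tendsto (fun e => ‖φ e‖) (CStarAlgebra.approximateUnit A) (𝓝 N) := by
    refine tendsto_order.mpr ⟨fun M hM => ?_, fun M hM => ?_⟩
    · obtain ⟨e, he, he1, hMe⟩ := key M hM
      filter_upwards [(CStarAlgebra.hasBasis_approximateUnit A).mem_of_mem ⟨he, he1⟩] with x hx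
      exact hMe.trans_le ((hmono e x hx.1).resolve_right (not_not.mpr he))
    · filter_upwards [hl.eventually_norm] with e he
      refine (norm_apply_le φ e).trans_lt (lt_of_le_of_lt ?_ hM)
      exact mul_le_of_le_one_right (norm_nonneg _) he
  refine ((Complex.continuous_ofReal.tendsto N).comp hreal).congr' ?_
  filter_upwards [hl.eventually_nonneg] with e he
  exact (Complex.eq_coe_norm_of_nonneg (h e he)).symm

/-- The norm is additive on positive functionals. -/
lemma norm_add_of_nonneg {φ ψ : WeakDual ℂ A} (hφ : ∀ a : A, 0 ≤ a → 0 ≤ φ a)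
    (hψ : ∀ a : A, 0 ≤ a → 0 ≤ ψ a) :
    ‖WeakDual.toStrongDual (φ + ψ)‖ = ‖WeakDual.toStrongDual φ‖ + ‖WeakDual.toStrongDual ψ‖ := by
  have hl := CStarAlgebra.increasingApproximateUnit A
  have := hl.neBot
  have h1 := (tendsto_approximateUnit hφ).add (tendsto_approximateUnit hψ)
  have h2 := tendsto_approximateUnit (φ := φ + ψ) fun a ha => add_nonneg (hφ a ha) (hψ a ha)
  exact_mod_cast tendsto_nhds_unique h2 h1

omit [StarOrderedRing A] in
lemma smul_mem_stateSpace {ψ : WeakDual ℂ A} (hψ : ∀ a : A, 0 ≤ a → 0 ≤ ψ a)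
    (hne : ‖WeakDual.toStrongDual ψ‖ ≠ 0) :
    ‖WeakDual.toStrongDual ψ‖⁻¹ • ψ ∈ stateSpace A := by
  refine ⟨fun a ha => ?_, ?_⟩
  · rw [real_smul_apply]
    have : (0 : ℂ) ≤ (‖WeakDual.toStrongDual ψ‖⁻¹ : ℝ) := by
      exact_mod_cast inv_nonneg.mpr (norm_nonneg _)
    exact mul_nonneg this (hψ a ha)
  · change ‖‖WeakDual.toStrongDual ψ‖⁻¹ • WeakDual.toStrongDual ψ‖ = 1
    rw [norm_smul, norm_inv, norm_norm, inv_mul_cancel₀ hne]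

omit [PartialOrder A] [StarOrderedRing A] in
lemma eq_zero_of_norm_eq_zero {ψ : WeakDual ℂ A} (h : ‖WeakDual.toStrongDual ψ‖ = 0) : ψ = 0 := by
  rw [norm_eq_zero] at h
  exact (map_eq_zero_iff _ WeakDual.toStrongDual.injective).mp h

/-- A positive functional dominated by a pure state is a multiple of it. -/
lemma eq_norm_smul_of_add_mem_pureStates {ψ χ : WeakDual ℂ A} (hψ : ∀ a : A, 0 ≤ a → 0 ≤ ψ a)
    (hχ : ∀ a : A, 0 ≤ a → 0 ≤ χ a) (h : ψ + χ ∈ pureStates A) :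
    ψ = ‖WeakDual.toStrongDual ψ‖ • (ψ + χ) := by
  have hsum : ‖WeakDual.toStrongDual ψ‖ + ‖WeakDual.toStrongDual χ‖ = 1 := by
    rw [← norm_add_of_nonneg hψ hχ]; exact h.1.2
  by_cases h1 : ‖WeakDual.toStrongDual ψ‖ = 0
  · refine DFunLike.ext _ _ fun a => ?_
    rw [real_smul_apply, h1, eq_zero_of_norm_eq_zero h1, Complex.ofReal_zero, zero_mul]
    rfl
  by_cases h2 : ‖WeakDual.toStrongDual χ‖ = 0
  · refine DFunLike.ext _ _ fun a => ?_
    rw [h2, add_zero] at hsum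
    rw [real_smul_apply, hsum, eq_zero_of_norm_eq_zero h2]
    simp
  have hinv : ∀ {ω : WeakDual ℂ A}, ‖WeakDual.toStrongDual ω‖ ≠ 0 →
      ‖WeakDual.toStrongDual ω‖ • (‖WeakDual.toStrongDual ω‖⁻¹ • ω) = ω := fun {ω} hω => by
    refine DFunLike.ext _ _ fun a => ?_
    rw [real_smul_apply, real_smul_apply, ← mul_assoc, ← Complex.ofReal_mul, mul_inv_cancel₀ hω]
    simp
  -- By additivity of the norm, the two norms serve as convex weights on the normalized functionals.
  have hmem : ψ + χ ∈ openSegment ℝ (‖WeakDual.toStrongDual ψ‖⁻¹ • ψ)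
      (‖WeakDual.toStrongDual χ‖⁻¹ • χ) :=
    ⟨‖WeakDual.toStrongDual ψ‖, ‖WeakDual.toStrongDual χ‖, by positivity, by positivity,
      hsum, congrArg₂ (· + ·) (hinv h1) (hinv h2)⟩
  rw [← ((mem_extremePoints.mp h).2 _ (smul_mem_stateSpace hψ h1) _
    (smul_mem_stateSpace hχ h2) hmem).1]
  exact (hinv h1).symm

/-- Pure states of a commutative algebra are multiplicative. -/
lemma map_mul_of_mem_pureStates (hcomm : ∀ a b : A, a * b = b * a) {φ : WeakDual ℂ A}
    (hφ : φ ∈ pureStates A) (a b : A) : φ (a * b) = φ a * φ b := by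
  have hl := CStarAlgebra.increasingApproximateUnit A
  have := hl.neBot
  have hball : ∀ b : A, 0 ≤ b → ‖b‖ ≤ 1 → ∀ a, φ (a * b) = φ a * φ b := by
    intro b hb hb1
    let ψ : WeakDual ℂ A := StrongDual.toWeakDual
      ((WeakDual.toStrongDual φ).comp ((ContinuousLinearMap.mul ℂ A).flip b))
    have hψa : ∀ a, ψ a = φ (a * b) := fun _ => rfl
    have hψ : ∀ a : A, 0 ≤ a → 0 ≤ ψ a := fun a ha =>
      hφ.1.1 _ (Commute.mul_nonneg ha hb (hcomm a b))
    have hχ : ∀ a : A, 0 ≤ a → 0 ≤ (φ - ψ) a := fun a ha => by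
      -- Here ab = √a b √a ≤ ‖b‖ a ≤ a.
      have hle : a * b ≤ a := by
        have h := CStarAlgebra.star_left_conjugate_le_norm_smul (a := CFC.sqrt a) (b := b)
          (.of_nonneg hb)
        rw [(IsSelfAdjoint.of_nonneg (CFC.sqrt_nonneg a)).star_eq, hcomm _ b, mul_assoc,
          CFC.sqrt_mul_sqrt_self a ha, hcomm b a] at h
        exact h.trans (by simpa using smul_le_smul_of_nonneg_right hb1 ha)
      change 0 ≤ φ a - φ (a * b)
      rw [← map_sub]
      exact hφ.1.1 _ (sub_nonneg.mpr hle)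
    have hsum : ψ + (φ - ψ) = φ := by abel
    have h := eq_norm_smul_of_add_mem_pureStates hψ hχ (hsum.symm ▸ hφ)
    rw [hsum] at h
    have hmul : ∀ a, φ (a * b) = ‖WeakDual.toStrongDual ψ‖ * φ a := fun a => by
      rw [← hψa, ← real_smul_apply, ← h]
    have hlim := (tendsto_approximateUnit hφ.1.1).const_mul (‖WeakDual.toStrongDual ψ‖ : ℂ)
    rw [hφ.1.2, Complex.ofReal_one, mul_one] at hlim
    -- Evaluating φ(eb) = ‖ψ‖ φ(e) along the approximate unit identifies the constant.
    have hb' : (‖WeakDual.toStrongDual ψ‖ : ℂ) = φ b := by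
      refine tendsto_nhds_unique hlim (((φ.continuous.tendsto b).comp
        (hl.tendsto_mul_right b)).congr fun e => ?_)
      exact hmul e
    intro a
    rw [hmul, hb', mul_comm]
  have hpos : ∀ b : A, 0 ≤ b → φ (a * b) = φ a * φ b := by
    intro b hb
    have hr : ((‖b‖ + 1 : ℝ) : ℂ) ≠ 0 := by
      exact_mod_cast (by positivity : ‖b‖ + 1 ≠ 0)
    have h := hball ((‖b‖ + 1)⁻¹ • b) (smul_nonneg (by positivity) hb) (by
      rw [norm_smul, norm_inv, Real.norm_of_nonneg (by positivity)]
      exact inv_mul_le_one_of_le₀ (by linarith) (by positivity)) a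
    rw [← Complex.coe_smul, mul_smul_comm, map_smul, map_smul, smul_eq_mul, smul_eq_mul,
      mul_left_comm] at h
    refine mul_left_cancel₀ ?_ h
    rw [Complex.ofReal_inv]
    exact inv_ne_zero hr
  obtain ⟨x, hx, -, rfl⟩ := CStarAlgebra.exists_sum_four_nonneg b
  simp only [Finset.mul_sum, map_sum, mul_smul_comm, map_smul, hpos _ (hx _), smul_eq_mul,
    mul_left_comm]

/-- For fixed `a`, `b` the identity is a weak-⋆ closed condition on the functional. -/
lemma map_mul_of_mem_pureSpace (hcomm : ∀ a b : A, a * b = b * a) {φ : WeakDual ℂ A}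
    (hφ : φ ∈ pureSpace A) (a b : A) : φ (a * b) = φ a * φ b := by
  have hcl : IsClosed {ψ : WeakDual ℂ A | ψ (a * b) = ψ a * ψ b} :=
    isClosed_eq (WeakDual.eval_continuous _)
      ((WeakDual.eval_continuous a).mul (WeakDual.eval_continuous b))
  exact closure_minimal (fun ψ hψ => map_mul_of_mem_pureStates hcomm hψ a b) hcl hφ.1

end CStarQuantum

namespace CStarQuantum

/-! ### Positive functionals separate points. -/

section Separation

variable {A : Type*} [NonUnitalCStarAlgebra A] [PartialOrder A] [StarOrderedRing A]

/-- A real-linear functional, restricted to the self-adjoint part and extended complex-linearly. -/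
noncomputable def complexExtension (f : A →ₗ[ℝ] ℝ) : A →ₗ[ℂ] ℂ where
  toFun a := f (realPart a : A) + f (imaginaryPart a : A) * Complex.I
  map_add' a b := by simp; ring
  map_smul' c a := by
    simp only [realPart_smul, imaginaryPart_smul, AddSubgroup.coe_sub, AddSubgroup.coe_add,
      selfAdjoint.val_smul, map_sub, map_add, map_smul, smul_eq_mul, RingHom.id_apply]
    apply Complex.ext <;> simp

omit [PartialOrder A] [StarOrderedRing A] in
lemma complexExtension_of_isSelfAdjoint (f : A →ₗ[ℝ] ℝ) {a : A} (ha : IsSelfAdjoint a) :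
    complexExtension f a = f a := by
  simp [complexExtension, ha.coe_realPart, ha.imaginaryPart]

/-- A self-adjoint element that is killed by all positive functionals is nonnegative. -/
lemma nonneg_of_forall_apply_eq_zero {a : A} (ha : IsSelfAdjoint a)
    (h : ∀ f : A →ₚ[ℂ] ℂ, f a = 0) : 0 ≤ a := by
  let C : ProperCone ℝ A :=
    { ConvexCone.toPointedCone
        { carrier := {x : A | 0 ≤ x}
          smul_mem' := fun _ hc _ hx => smul_nonneg hc.le hx
          add_mem' := fun _ hx _ hy => add_nonneg hx hy } (le_refl (0 : A)) with
      isClosed' := CStarAlgebra.isClosed_nonneg }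
  by_contra hna
  -- The separating real functional is nonnegative on the positive cone and negative at `a`; its
  -- complex extension is then a positive functional not killing `a`.
  obtain ⟨f, hf, hfa⟩ := ProperCone.hyperplane_separation_point C (x₀ := a) hna
  have := h (PositiveLinearMap.mk₀ (complexExtension (f : A →ₗ[ℝ] ℝ)) fun x hx => by
    rw [complexExtension_of_isSelfAdjoint _ (.of_nonneg hx)]
    exact_mod_cast hf x hx)
  have h0 : complexExtension (f : A →ₗ[ℝ] ℝ) a = 0 := this
  rw [complexExtension_of_isSelfAdjoint _ ha] at h0
  exact hfa.ne (by exact_mod_cast h0)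

/-- Positive functionals separate points. -/
lemma eq_zero_of_forall_apply_eq_zero {a : A} (h : ∀ f : A →ₚ[ℂ] ℂ, f a = 0) : a = 0 := by
  have hsa : ∀ b : A, IsSelfAdjoint b → (∀ f : A →ₚ[ℂ] ℂ, f b = 0) → b = 0 := fun b hb hb0 =>
    le_antisymm (by
      have := nonneg_of_forall_apply_eq_zero hb.neg fun f => by simp [hb0]
      simpa using this) (nonneg_of_forall_apply_eq_zero hb hb0)
  have hstar : ∀ f : A →ₚ[ℂ] ℂ, f (star a) = 0 := fun f => by rw [map_star, h, star_zero]
  have hre : (realPart a : A) = 0 := hsa _ (realPart a).2 fun f => by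
    rw [realPart_apply_coe, ← Complex.coe_smul, map_smul, map_add, h, hstar]; simp
  have him : (imaginaryPart a : A) = 0 := hsa _ (imaginaryPart a).2 fun f => by
    rw [imaginaryPart_apply_coe, ← Complex.coe_smul, map_smul, map_smul, map_sub, h, hstar]; simp
  rw [← realPart_add_I_smul_imaginaryPart a, hre, him]
  simp

end Separation

/-! ### Krein–Milman and separation by pure states. -/

section KreinMilman

variable (A : Type*) [NonUnitalCStarAlgebra A] [PartialOrder A]

/-- The positive functionals of norm at most one. -/
def quasiStateSpace : Set (WeakDual ℂ A) :=
  {φ | (∀ a : A, 0 ≤ a → 0 ≤ φ a) ∧ ‖WeakDual.toStrongDual φ‖ ≤ 1}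

/-- Compactness is why norms below one are allowed: without a unit, the states need not be weak-⋆
closed. -/
lemma isCompact_quasiStateSpace : IsCompact (quasiStateSpace A) := by
  have h : quasiStateSpace A = (⇑WeakDual.toStrongDual ⁻¹' Metric.closedBall (0 : StrongDual ℂ A) 1)
      ∩ {φ : WeakDual ℂ A | ∀ a : A, 0 ≤ a → 0 ≤ φ a} := by
    ext φ
    simp only [quasiStateSpace, Set.mem_ofPred_eq, Set.mem_inter_iff, Set.mem_preimage,
      mem_closedBall_zero_iff]
    tauto
  rw [h]
  refine (WeakDual.isCompact_closedBall 0 1).inter_right ?_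
  simp only [Set.ofPred_forall]
  exact isClosed_iInter fun a => isClosed_iInter fun _ =>
    isClosed_Ici.preimage (WeakDual.eval_continuous a)

lemma convex_quasiStateSpace : Convex ℝ (quasiStateSpace A) := by
  intro φ hφ ψ hψ s t hs ht hst
  refine ⟨fun a ha => ?_, ?_⟩
  · change 0 ≤ (s • φ) a + (t • ψ) a
    rw [real_smul_apply, real_smul_apply]
    exact add_nonneg (mul_nonneg (by exact_mod_cast hs) (hφ.1 a ha))
      (mul_nonneg (by exact_mod_cast ht) (hψ.1 a ha))
  · change ‖s • WeakDual.toStrongDual φ + t • WeakDual.toStrongDual ψ‖ ≤ 1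
    have := convex_closedBall (0 : StrongDual ℂ A) 1 (x := WeakDual.toStrongDual φ)
      (by simpa using hφ.2) (y := WeakDual.toStrongDual ψ) (by simpa using hψ.2) hs ht hst
    simpa using this

variable {A}

/-- A nonzero functional of norm below one lies strictly between 0 and its normalization, so it is
not extreme. -/
lemma mem_pureStates_of_mem_extremePoints {φ : WeakDual ℂ A}
    (hφ : φ ∈ (quasiStateSpace A).extremePoints ℝ) (h0 : φ ≠ 0) : φ ∈ pureStates A := by
  have hne : ‖WeakDual.toStrongDual φ‖ ≠ 0 := fun h => h0 (eq_zero_of_norm_eq_zero h)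
  have hnorm : ‖WeakDual.toStrongDual φ‖ = 1 := by
    by_contra hlt
    have hlt : ‖WeakDual.toStrongDual φ‖ < 1 := lt_of_le_of_ne hφ.1.2 hlt
    have hs := smul_mem_stateSpace hφ.1.1 hne
    refine h0 ((mem_extremePoints.mp hφ).2 0 ⟨fun a _ => le_rfl, ?_⟩ _ ⟨hs.1, hs.2.le⟩
      ⟨1 - ‖WeakDual.toStrongDual φ‖, ‖WeakDual.toStrongDual φ‖, by linarith, by positivity,
        by ring, ?_⟩).1.symm
    · rw [map_zero, norm_zero]; exact zero_le_one
    · refine DFunLike.ext _ _ fun a => ?_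
      change ((1 - ‖WeakDual.toStrongDual φ‖) • (0 : WeakDual ℂ A)) a +
        (‖WeakDual.toStrongDual φ‖ • (‖WeakDual.toStrongDual φ‖⁻¹ • φ)) a = φ a
      rw [real_smul_apply, real_smul_apply, real_smul_apply, ← mul_assoc, ← Complex.ofReal_mul,
        mul_inv_cancel₀ hne]
      change _ * (0 : ℂ) + _ = _
      simp
  exact inter_extremePoints_subset_extremePoints_of_subset (𝕜 := ℝ)
    (fun ψ hψ => ⟨hψ.1, hψ.2.le⟩ : stateSpace A ⊆ quasiStateSpace A) ⟨⟨hφ.1.1, hnorm⟩, hφ⟩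

omit [PartialOrder A] in
lemma locallyConvexSpace_weakDual : LocallyConvexSpace ℝ (WeakDual ℂ A) :=
  LocallyConvexSpace.induced (𝕜 := ℝ)
    ({ toFun := fun φ a => φ a
       map_add' := fun _ _ => rfl
       map_smul' := fun _ _ => rfl } : WeakDual ℂ A →ₗ[ℝ] (A → ℂ))

/-- Pure states separate points. -/
lemma eq_zero_of_forall_pureStates [StarOrderedRing A] {a : A} (h : ∀ φ ∈ pureStates A, φ a = 0) :
    a = 0 := by
  let N : Set (WeakDual ℂ A) := {φ | φ a = 0}
  have hN : IsClosed N := isClosed_eq (WeakDual.eval_continuous a) continuous_const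
  have hNc : Convex ℝ N := by
    intro φ hφ ψ hψ s t _ _ _
    change (s • φ) a + (t • ψ) a = 0
    rw [real_smul_apply, real_smul_apply, show φ a = 0 from hφ, show ψ a = 0 from hψ]
    simp
  have hQ : quasiStateSpace A ⊆ N := by
    have hKM := @closure_convexHull_extremePoints (WeakDual ℂ A) _ _ _ _ _
      (WeakDual.instContinuousSMul ℝ) locallyConvexSpace_weakDual _ (isCompact_quasiStateSpace A) (convex_quasiStateSpace A)
    rw [← hKM]
    refine closure_minimal (convexHull_min (fun φ hφ => ?_) hNc) hN
    -- Zero may be an extreme point without being a pure state, but it vanishes at `a` anyway.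
    by_cases h0 : φ = 0
    · rw [h0]; rfl
    · exact h φ (mem_pureStates_of_mem_extremePoints hφ h0)
  refine eq_zero_of_forall_apply_eq_zero fun f => ?_
  let φ : WeakDual ℂ A := StrongDual.toWeakDual ⟨f.toLinearMap, map_continuous f⟩
  have hφ : ∀ a : A, 0 ≤ a → 0 ≤ φ a := fun a ha => f.map_nonneg ha
  change φ a = 0
  by_cases hne : ‖WeakDual.toStrongDual φ‖ = 0
  · rw [eq_zero_of_norm_eq_zero hne]; rfl
  · have hs := smul_mem_stateSpace hφ hne
    have : (‖WeakDual.toStrongDual φ‖⁻¹ • φ) a = 0 := hQ ⟨hs.1, hs.2.le⟩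
    rw [real_smul_apply] at this
    exact (mul_eq_zero.mp this).resolve_left (by exact_mod_cast inv_ne_zero hne)

end KreinMilman

end CStarQuantum

namespace CStarQuantum

/-! ### Unitary conjugation of functionals. -/

section UnitaryOrbit

variable {A : Type*} [NonUnitalCStarAlgebra A]

/-- Right multiplication on `A` by an element of its unitization. -/
noncomputable def rmul (u : Unitization ℂ A) : A →L[ℂ] A :=
  u.fst • ContinuousLinearMap.id ℂ A + (ContinuousLinearMap.mul ℂ A).flip u.snd

/-- Left multiplication on `A` by an element of its unitization. -/
noncomputable def lmul (u : Unitization ℂ A) : A →L[ℂ] A :=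
  u.fst • ContinuousLinearMap.id ℂ A + ContinuousLinearMap.mul ℂ A u.snd

lemma rmul_apply (u : Unitization ℂ A) (x : A) : rmul u x = u.fst • x + x * u.snd := rfl

lemma lmul_apply (u : Unitization ℂ A) (x : A) : lmul u x = u.fst • x + u.snd * x := rfl

lemma inr_rmul (u : Unitization ℂ A) (x : A) :
    (rmul u x : Unitization ℂ A) = (x : Unitization ℂ A) * u := by
  ext <;> simp [rmul_apply]

lemma inr_lmul (u : Unitization ℂ A) (x : A) :
    (lmul u x : Unitization ℂ A) = u * (x : Unitization ℂ A) := by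
  ext <;> simp [lmul_apply]

/-- Conjugation `x ↦ u⋆ x u` on `A` by an element of its unitization. -/
noncomputable def conj (u : Unitization ℂ A) : A →L[ℂ] A := (lmul (star u)).comp (rmul u)

lemma inr_conj (u : Unitization ℂ A) (x : A) :
    (conj u x : Unitization ℂ A) = star u * ((x : Unitization ℂ A) * u) := by
  rw [conj, ContinuousLinearMap.comp_apply, inr_lmul, inr_rmul]

variable {u : Unitization ℂ A}

lemma norm_conj_le (hu : u ∈ unitary (Unitization ℂ A)) (x : A) : ‖conj u x‖ ≤ ‖x‖ := by
  rw [← Unitization.norm_inr (𝕜 := ℂ) (conj u x), ← Unitization.norm_inr (𝕜 := ℂ) x, inr_conj,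
    CStarRing.norm_mem_unitary_mul _ (Unitary.star_mem hu), CStarRing.norm_mul_mem_unitary _ hu]

lemma conj_conj_star (hu : u ∈ unitary (Unitization ℂ A)) (x : A) :
    conj u (conj (star u) x) = x := by
  apply Unitization.inr_injective (R := ℂ)
  rw [inr_conj, inr_conj, star_star, mul_assoc u, mul_assoc (x : Unitization ℂ A),
    Unitary.star_mul_self_of_mem hu, mul_one, ← mul_assoc, Unitary.star_mul_self_of_mem hu, one_mul]

lemma conj_nonneg [PartialOrder A] [StarOrderedRing A] (u : Unitization ℂ A) {x : A} (hx : 0 ≤ x) :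
    0 ≤ conj u x := by
  rw [← Unitization.inr_nonneg_iff, inr_conj, ← mul_assoc]
  exact star_left_conjugate_nonneg (Unitization.inr_nonneg_iff.mpr hx) u

/-- This turns invariance of φ under conjugation by u into φ(xu) = φ(ux). -/
lemma conj_lmul (hu : u ∈ unitary (Unitization ℂ A)) (x : A) : conj u (lmul u x) = rmul u x := by
  apply Unitization.inr_injective (R := ℂ)
  rw [inr_conj, inr_lmul, inr_rmul, mul_assoc, ← mul_assoc (star u),
    Unitary.star_mul_self_of_mem hu, one_mul]

/-- Right multiplication by a unitary of the unitization, as a linear equivalence. -/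
noncomputable def rmulEquiv (hu : u ∈ unitary (Unitization ℂ A)) : A ≃ₗ[ℂ] A :=
  LinearEquiv.ofLinearMap (rmul u).toLinearMap (rmul (star u)).toLinearMap
    (by
      ext x
      apply Unitization.inr_injective (R := ℂ)
      simp [inr_rmul, mul_assoc, Unitary.star_mul_self_of_mem hu])
    (by
      ext x
      apply Unitization.inr_injective (R := ℂ)
      simp [inr_rmul, mul_assoc, Unitary.mul_star_self_of_mem hu])

lemma rmulEquiv_apply (hu : u ∈ unitary (Unitization ℂ A)) (x : A) : rmulEquiv hu x = rmul u x :=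
  rfl

/-- Precomposition of a functional with conjugation by `u`. -/
noncomputable def rotate (u : Unitization ℂ A) (φ : WeakDual ℂ A) : WeakDual ℂ A :=
  StrongDual.toWeakDual ((WeakDual.toStrongDual φ).comp (conj u))

lemma rotate_apply (u : Unitization ℂ A) (φ : WeakDual ℂ A) (x : A) :
    rotate u φ x = φ (conj u x) := rfl

lemma rotate_star_rotate (hu : u ∈ unitary (Unitization ℂ A)) (φ : WeakDual ℂ A) :
    rotate (star u) (rotate u φ) = φ :=
  DFunLike.ext _ _ fun x => by rw [rotate_apply, rotate_apply, conj_conj_star hu]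

lemma norm_rotate_le (hu : u ∈ unitary (Unitization ℂ A)) (φ : WeakDual ℂ A) :
    ‖WeakDual.toStrongDual (rotate u φ)‖ ≤ ‖WeakDual.toStrongDual φ‖ :=
  ContinuousLinearMap.opNorm_le_bound _ (norm_nonneg _) fun x =>
    (norm_apply_le φ _).trans (by gcongr; exact norm_conj_le hu x)

variable [PartialOrder A] [StarOrderedRing A]

lemma rotate_mem_stateSpace (hu : u ∈ unitary (Unitization ℂ A)) {φ : WeakDual ℂ A}
    (hφ : φ ∈ stateSpace A) : rotate u φ ∈ stateSpace A := by
  refine ⟨fun x hx => hφ.1 _ (conj_nonneg u hx), le_antisymm ?_ ?_⟩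
  · exact (norm_rotate_le hu φ).trans hφ.2.le
  · rw [← hφ.2]
    nth_rewrite 1 [← rotate_star_rotate hu φ]
    exact norm_rotate_le (Unitary.star_mem hu) _

/-- Conjugation is an affine bijection of the state space, with inverse given by u⋆, so it preserves
extreme points. -/
lemma rotate_mem_pureStates (hu : u ∈ unitary (Unitization ℂ A)) {φ : WeakDual ℂ A}
    (hφ : φ ∈ pureStates A) : rotate u φ ∈ pureStates A := by
  have hinv : ∀ ψ : WeakDual ℂ A, rotate u (rotate (star u) ψ) = ψ := fun ψ => by
    have := rotate_star_rotate (Unitary.star_mem hu) ψ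
    rwa [star_star] at this
  refine mem_extremePoints.mpr ⟨rotate_mem_stateSpace hu hφ.1, ?_⟩
  rintro ψ hψ χ hχ ⟨s, t, hs, ht, hst, h⟩
  have hseg : φ ∈ openSegment ℝ (rotate (star u) ψ) (rotate (star u) χ) := by
    refine ⟨s, t, hs, ht, hst, ?_⟩
    rw [← rotate_star_rotate hu φ, ← h]
    rfl
  obtain ⟨h1, h2⟩ := (mem_extremePoints.mp hφ).2 _ (rotate_mem_stateSpace (Unitary.star_mem hu) hψ) _
    (rotate_mem_stateSpace (Unitary.star_mem hu) hχ) hseg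
  exact ⟨by rw [← h1, hinv], by rw [← h2, hinv]⟩

omit [StarOrderedRing A] in
lemma pureStates_subset_pureSpace : pureStates A ⊆ pureSpace A := fun φ hφ =>
  ⟨subset_closure hφ, fun h0 => by
    have h := hφ.1.2
    rw [Set.mem_singleton_iff.mp h0, map_zero, norm_zero] at h
    exact zero_ne_one h⟩

/-- The GNS representations of unitarily conjugate pure states are equivalent. -/
lemma gnsRel_rotate (hu : u ∈ unitary (Unitization ℂ A)) {φ : WeakDual ℂ A}
    (hφ : φ ∈ pureStates A) :
    gnsRel A ⟨rotate u φ, pureStates_subset_pureSpace (rotate_mem_pureStates hu hφ)⟩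
      ⟨φ, pureStates_subset_pureSpace hφ⟩ := by
  -- Right multiplication commutes with left multiplication, and u⋆(x⋆x)u = (xu)⋆(xu).
  refine PositiveLinearMap.unitarilyEquivalent_gns_of_linearEquiv _ _ (rmulEquiv hu)
    (fun a x => ?_) fun x => ?_
  · simp [rmulEquiv_apply, rmul_apply, mul_add, mul_assoc, mul_smul_comm]
  · rw [toPositive_apply, toPositive_apply, rotate_apply]
    congr 1
    apply Unitization.inr_injective (R := ℂ)
    rw [inr_conj, Unitization.inr_mul, Unitization.inr_mul, Unitization.inr_star,
      Unitization.inr_star, rmulEquiv_apply, inr_rmul, star_mul]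
    simp only [mul_assoc]

omit [PartialOrder A] [StarOrderedRing A] in
/-- A functional which is fixed by all unitary conjugations is tracial. -/
lemma map_mul_comm_of_rotate_eq {φ : WeakDual ℂ A}
    (h : ∀ u ∈ unitary (Unitization ℂ A), rotate u φ = φ) (a b : A) : φ (a * b) = φ (b * a) := by
  -- The condition φ(au) = φ(ua) is linear in u, so it extends from unitaries to their span.
  let S : Submodule ℂ (Unitization ℂ A) :=
    { carrier := {u | φ (rmul u a) = φ (lmul u a)}
      add_mem' := fun {u v} hu hv => by
        simp only [Set.mem_ofPred_eq, rmul_apply, lmul_apply, map_add, Unitization.fst_add,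
          Unitization.snd_add, add_smul, mul_add, add_mul] at hu hv ⊢
        linear_combination hu + hv
      zero_mem' := by simp [rmul_apply, lmul_apply]
      smul_mem' := fun c u hu => by
        simp only [Set.mem_ofPred_eq, rmul_apply, lmul_apply, map_add, Unitization.fst_smul,
          Unitization.snd_smul, mul_smul_comm, smul_mul_assoc, map_smul,
          smul_eq_mul] at hu ⊢
        linear_combination c * hu }
  have hS : S = ⊤ := by
    rw [eq_top_iff, ← CStarAlgebra.span_unitary]
    refine Submodule.span_le.mpr fun u hu => ?_
    change φ (rmul u a) = φ (lmul u a)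
    rw [← conj_lmul hu, ← rotate_apply, h u hu]
  have hb : (b : Unitization ℂ A) ∈ S := hS ▸ Submodule.mem_top
  have hb' : φ (rmul (b : Unitization ℂ A) a) = φ (lmul (b : Unitization ℂ A) a) := hb
  simpa [rmul_apply, lmul_apply] using hb'

end UnitaryOrbit

end CStarQuantum

theorem proposition1 (A : Type*) [NonUnitalCStarAlgebra A] [PartialOrder A] [StarOrderedRing A] :
    (∀ a b : A, a * b = b * a) ↔
      ∀ C ∈ (CStarQuantum.gnsRel A).classes, ∃ α : CStarQuantum.pureSpace A, C = {α} := by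
  constructor
  · rintro hcomm _ ⟨α, rfl⟩
    refine ⟨α, Set.eq_singleton_iff_unique_mem.mpr ⟨(CStarQuantum.gnsRel A).refl α, ?_⟩⟩
    exact fun β hβ => CStarQuantum.eq_of_gnsRel_of_multiplicative
      (CStarQuantum.map_mul_of_mem_pureSpace hcomm β.2)
      (CStarQuantum.map_mul_of_mem_pureSpace hcomm α.2) hβ
  · intro h a b
    rw [← sub_eq_zero]
    refine CStarQuantum.eq_zero_of_forall_pureStates fun φ hφ => ?_
    rw [map_sub, sub_eq_zero]
    refine CStarQuantum.map_mul_comm_of_rotate_eq (fun u hu => ?_) a b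
    obtain ⟨α, hα⟩ := h _ ((CStarQuantum.gnsRel A).mem_classes
      ⟨φ, CStarQuantum.pureStates_subset_pureSpace hφ⟩)
    have h1 := hα.subset (CStarQuantum.gnsRel_rotate hu hφ)
    have h2 := hα.subset ((CStarQuantum.gnsRel A).refl _)
    exact congrArg Subtype.val (h1.trans h2.symm)
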